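/- Let $G$ be a finite group and let $\alpha:G\times G\to\mathbb{C}$ be a unitary cocycle, i.e. $\alpha(x,y)\alpha(xy,z)=\alpha(x,yz)\alpha(y,z)$ and $|\alpha(x,y)|=1$ for all $x,y,z\in G$. A projective representation of $G$ for $\alpha$ is a map $\rho:G\to\mathrm{GL}(V)$ with $\rho(g)\rho(h)=\alpha(g,h)\rho(gh)$; it is irreducible if $V\neq 0$ and $0,V$ are the only $G$-invariant subspaces; $\rho$ and $\sigma$ are equivalent if $\sigma=T\rho T^{-1}$ for an invertible linear map $T$. Let $R$ be a complete set of irreducible unitary projective representations $\xi:G\to\mathrm{U}(\mathbb{C}^{d_\xi})$ for $\alpha$, i.e. every irreducible projective representation of $G$ for $\alpha$ is equivalent to exactly one $\xi\in R$. For $f:G\to\mathbb{C}$ let $M_\alpha(f)\in\mathbb{C}^{G\times G}$ be the matrix $$M_\alpha(f)_{g,h}=\frac{f(g^{-1}h)}{\alpha(g,g^{-1}h)},$$ and for $\xi\in R$ define the Fourier coefficient $$(F_\alpha f)_\xi=\sum_{a\in G}\frac{f(a)\,\xi(a^{-1})}{\alpha(a,a^{-1})\,\alpha(1,1)}.$$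 Suppose that $M_\alpha(f)$ is an orthogonal projection. Then $R$ is finite, each $(F_\alpha f)_\xi$, $\xi\in R$, is an orthogonal projection, and hence can be written as $$(F_\alpha f)_\xi=\sum_{j=1}^{m_\xi}w_{\xi,j}w_{\xi,j}^*,\qquad \langle w_{\xi,j},w_{\xi,k}\rangle=\delta_{jk},\qquad w_\xi=(w_{\xi,1},\ldots,w_{\xi,m_\xi})\in(\mathbb{C}^{d_\xi})^{m_\xi}.$$ For every choice of such $m_\xi$ and $w_{\xi,j}$ one has $m_\xi=\mathrm{rank}\,(F_\alpha f)_\xi$. Moreover, let $$v:=\Bigl(\sqrt{\tfrac{d_\xi}{|G|}}\,w_\xi\Bigr)_{\xi\in R}\in V:=\bigoplus_{\xi\in R}(\mathbb{C}^{d_\xi})^{m_\xi}$$ (an orthogonal direct sum), and let $\rho(g):V\to V$ be the unitary map $$\rho(g)\bigl((v_{\xi,1},\ldots,v_{\xi,m_\xi})_{\xi\in R}\bigr):=(\xi(g)v_{\xi,1},\ldots,\xi(g)v_{\xi,m_\xi})_{\xi\in R}.$$ Then $(\rho(g)v)_{g\in G}$ is a normalised tight $(G,\alpha)$-frame for $V$,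 i.e. $\rho$ is a unitary projective representation of $G$ for $\alpha$, and $x=\sum_{g\in G}\langle x,\rho(g)v\rangle\,\rho(g)v$ for all $x\in V$, where the inner product is linear in its first argument. Its Gramian, the matrix with $(g,h)$-entry $\langle\rho(h)v,\rho(g)v\rangle$, is exactly $M_\alpha(f)$. Also, $v\neq0$ if and only if $f\neq 0$. -/

import Mathlib

namespace TwistedFrame

section Representations

variable {G : Type*} [Group G]

/-- A unitary cocycle (2-cocycle, multiplier) of `G`: a map `α : G × G → ℂ` with
`α(x,y) α(xy,z) = α(x,yz) α(y,z)` and `|α(x,y)| = 1`. -/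
structure IsUnitaryCocycle (α : G → G → ℂ) : Prop where
  cocycle : ∀ x y z : G, α x y * α (x * y) z = α x (y * z) * α y z
  norm_eq_one : ∀ x y : G, ‖α x y‖ = 1

variable {V : Type*} [AddCommGroup V] [Module ℂ V]
variable {W : Type*} [AddCommGroup W] [Module ℂ W]

/-- `ρ : G → GL(V)` is a projective representation with cocycle `α`:
`ρ(g) ρ(h) = α(g,h) ρ(gh)`. -/
def IsProjRep (α : G → G → ℂ) (ρ : G → (V ≃ₗ[ℂ] V)) : Prop :=
  ∀ (g h : G) (x : V), ρ g (ρ h x) = α g h • ρ (g * h) x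

/-- Irreducibility: `V ≠ 0`, and the only `G`-invariant subspaces of `V` are `0` and `V`. -/
def IsIrred (ρ : G → (V ≃ₗ[ℂ] V)) : Prop :=
  Nontrivial V ∧
    ∀ U : Submodule ℂ V, (∀ (g : G), ∀ x ∈ U, ρ g x ∈ U) → U = ⊥ ∨ U = ⊤

/-- Equivalence of projective representations with the same cocycle: `σ = T ρ T⁻¹`
for an invertible linear map `T`. -/
def Equivalent (ρ : G → (V ≃ₗ[ℂ] V)) (σ : G → (W ≃ₗ[ℂ] W)) : Prop :=
  ∃ T : V ≃ₗ[ℂ] W, ∀ (g : G) (x : V), T (ρ g x) = σ g (T x)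

/-- The family `ξ i : G → U(ℂ^{d i})`, `i ∈ ι`, is a complete set of irreducible unitary projective
representations of `G` for the cocycle `α`: every irreducible projective representation of `G`
for `α` is equivalent to exactly one member of the family. -/
structure IsCompleteIrredSet (α : G → G → ℂ) {ι : Type*} (d : ι → ℕ)
    (ξ : (i : ι) → G → (EuclideanSpace ℂ (Fin (d i)) ≃ₗᵢ[ℂ] EuclideanSpace ℂ (Fin (d i)))) :
    Prop where
  projRep : ∀ i, IsProjRep α (fun g => (ξ i g).toLinearEquiv)
  irred : ∀ i, IsIrred (fun g => (ξ i g).toLinearEquiv)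
  inequivalent : ∀ i j,
    Equivalent (fun g => (ξ i g).toLinearEquiv) (fun g => (ξ j g).toLinearEquiv) → i = j
  complete : ∀ (n : ℕ)
    (ρ : G → (EuclideanSpace ℂ (Fin n) ≃ₗ[ℂ] EuclideanSpace ℂ (Fin n))),
    IsProjRep α ρ → IsIrred ρ → ∃ i, Equivalent ρ (fun g => (ξ i g).toLinearEquiv)

/-- The `(G,α)`-matrix `M_α(ν)`, with entries `ν(g⁻¹h) / α(g, g⁻¹h)`. -/
noncomputable def groupMatrix (α : G → G → ℂ) (ν : G → ℂ) : Matrix G G ℂ :=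
  Matrix.of fun g h => ν (g⁻¹ * h) / α g (g⁻¹ * h)

/-- The `α`-Fourier transform of `f : G → ℂ` at `ρ`, the linear map
`∑ a, f(a) ρ(a⁻¹) / (α(a,a⁻¹) α(1,1))`. -/
noncomputable def fourier [Fintype G] (α : G → G → ℂ) (f : G → ℂ) (ρ : G → (V ≃ₗ[ℂ] V)) :
    V →ₗ[ℂ] V :=
  ∑ a : G, (f a / (α a a⁻¹ * α 1 1)) • (ρ a⁻¹ : V →ₗ[ℂ] V)

end Representations

section Frames

/-- A finite sequence `φ` is a normalised tight (Parseval) frame for `E`: `x = ∑ j, ⟨x, φ j⟩ φ j`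
for all `x`. (Mathlib's inner product is linear in its second argument.) -/
def IsNormalisedTightFrame {J E : Type*} [Fintype J] [NormedAddCommGroup E]
    [InnerProductSpace ℂ E] (φ : J → E) : Prop :=
  ∀ x : E, x = ∑ j, (inner ℂ (φ j) x) • φ j

/-- The orbit `(ρ(g)v)_g` of `v` under `ρ : G → U(E)` is a normalised tight `(G,α)`-frame
for `E`: `ρ` is a unitary projective representation with cocycle `α` and the orbit is a normalised
tight frame for `E`. (The vector `v` can only be zero when `E` is.) -/
structure IsNormalisedTightGroupFrame {G E : Type*} [Group G] [Fintype G]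
    [NormedAddCommGroup E] [InnerProductSpace ℂ E] (α : G → G → ℂ) (ρ : G → (E ≃ₗᵢ[ℂ] E))
    (v : E) : Prop where
  projRep : IsProjRep α (fun g => (ρ g).toLinearEquiv)
  tight : IsNormalisedTightFrame (fun g => ρ g v)

end Frames

section Construction

variable {G : Type*} [Group G] [Fintype G] {ι : Type*} {d : ι → ℕ}

/-- `w` consists of orthonormal sequences `w_{ξ,1}, …, w_{ξ,m_ξ}` in `ℂ^{d_ξ}` with
`(F_α f)_ξ = ∑ j, w_{ξ,j} w_{ξ,j}^*`, for each `ξ` in the family. -/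
def IsFourierDecomposition (α : G → G → ℂ) (f : G → ℂ)
    (ξ : (i : ι) → G → (EuclideanSpace ℂ (Fin (d i)) ≃ₗᵢ[ℂ] EuclideanSpace ℂ (Fin (d i))))
    (m : ι → ℕ) (w : (i : ι) → Fin (m i) → EuclideanSpace ℂ (Fin (d i))) : Prop :=
  ∀ i, Orthonormal ℂ (w i) ∧
    fourier α f (fun g => (ξ i g).toLinearEquiv) =
      ∑ j, (InnerProductSpace.rankOne ℂ (w i j) (w i j)).toLinearMap

/-- The orthogonal direct sum `⊕_ξ (ℂ^{d_ξ})^{m_ξ}`. -/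
abbrev SumSpace (d m : ι → ℕ) : Type _ :=
  PiLp 2 (fun i : ι => PiLp 2 (fun _ : Fin (m i) => EuclideanSpace ℂ (Fin (d i))))

/-- The vector `v = (√(d_ξ/|G|) w_ξ)_ξ`. -/
noncomputable def constructVector (G : Type*) [Fintype G] {ι : Type*} {d m : ι → ℕ}
    (w : (i : ι) → Fin (m i) → EuclideanSpace ℂ (Fin (d i))) : SumSpace d m :=
  WithLp.toLp 2 fun i => WithLp.toLp 2 fun j =>
    ((Real.sqrt ((d i : ℝ) / (Fintype.card G : ℝ)) : ℝ) : ℂ) • w i j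

/-- The action `ρ(g)((v_{ξ,1}, …, v_{ξ,m_ξ})_ξ) = (ξ(g)v_{ξ,1}, …, ξ(g)v_{ξ,m_ξ})_ξ`. -/
noncomputable def constructAction [Fintype ι]
    (ξ : (i : ι) → G → (EuclideanSpace ℂ (Fin (d i)) ≃ₗᵢ[ℂ] EuclideanSpace ℂ (Fin (d i))))
    (m : ι → ℕ) (g : G) : SumSpace d m ≃ₗᵢ[ℂ] SumSpace d m :=
  LinearIsometryEquiv.piLpCongrRight 2 fun i =>
    LinearIsometryEquiv.piLpCongrRight 2 fun _ => ξ i g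

end Construction

end TwistedFrame

/-! Since `ξ` is unitary, the normalised `ξ(a⁻¹)` in the Fourier transform is `ξ(a)*`, so the
coefficient is `∑ f(a) ξ(a)*`. The first rows of `M² = M` and `M* = M` say that `f` is idempotent
for twisted convolution and invariant under the twisted involution. The transform carries these
properties to the coefficients, making each an orthogonal projection.

Schur orthogonality carries the rest: averaging a rank-one map over `G` gives an intertwiner, which
vanishes between inequivalent irreducibles and is otherwise a scalar fixed by its trace. With
orthonormal `w_{ξ,j}`, the weights `d_ξ/|G|` make the orbit a Parseval frame, whether or not the
`w_{ξ,j}` come from `f`.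

The Gramian also needs Fourier inversion. Schur shows that `∑ d_ξ/|G| ∑ ⟨ξ(c)w_{ξ,j}, w_{ξ,j}⟩`, as
a function of `c`, has the same coefficients as `f`. The transform is injective because a function
killed at all irreducibles is killed, by Maschke, at the twisted regular representation, where it
can be read off. -/

namespace TwistedFrame

section Cocycle

variable {G : Type*} [Group G] {α : G → G → ℂ}

theorem IsUnitaryCocycle.ne_zero (hα : IsUnitaryCocycle α) (x y : G) : α x y ≠ 0 := by
  intro h
  simpa [h] using hα.norm_eq_one x y

theorem IsUnitaryCocycle.one_left (hα : IsUnitaryCocycle α) (x : G) : α 1 x = α 1 1 := by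
  have h := hα.cocycle 1 1 x
  simp only [one_mul] at h
  exact (mul_right_cancel₀ (hα.ne_zero 1 x) h).symm

theorem IsUnitaryCocycle.one_right (hα : IsUnitaryCocycle α) (x : G) : α x 1 = α 1 1 := by
  have h := hα.cocycle x 1 1
  simp only [mul_one] at h
  exact mul_left_cancel₀ (hα.ne_zero x 1) h

theorem IsUnitaryCocycle.star_eq_inv (hα : IsUnitaryCocycle α) (x y : G) :
    (starRingEnd ℂ) (α x y) = (α x y)⁻¹ :=
  (Complex.inv_eq_conj (hα.norm_eq_one x y)).symm

end Cocycle

/-! ### Unitary projective representations and their Fourier coefficients -/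

section UnitaryRepresentations

variable {G : Type*} [Group G] {α : G → G → ℂ}
variable {E : Type*} [NormedAddCommGroup E] [InnerProductSpace ℂ E]
variable {F : Type*} [NormedAddCommGroup F] [InnerProductSpace ℂ F]
variable {ρ : G → (E ≃ₗᵢ[ℂ] E)} {σ : G → (F ≃ₗᵢ[ℂ] F)}

theorem IsProjRep.apply_apply (hρ : IsProjRep α (fun g => (ρ g).toLinearEquiv)) (g h : G) (x : E) :
    ρ g (ρ h x) = α g h • ρ (g * h) x :=
  hρ g h x

theorem IsProjRep.one_apply (hρ : IsProjRep α (fun g => (ρ g).toLinearEquiv)) (x : E) : ρ 1 x = α 1 1 • x := by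
  apply (ρ 1).injective
  rw [hρ.apply_apply, mul_one, map_smul]

theorem IsProjRep.symm_apply (hα : IsUnitaryCocycle α)
    (hρ : IsProjRep α (fun g => (ρ g).toLinearEquiv)) (g : G) (x : E) :
    (ρ g).symm x = (α g g⁻¹ * α 1 1)⁻¹ • ρ g⁻¹ x := by
  rw [LinearIsometryEquiv.symm_apply_eq, map_smul, hρ.apply_apply, mul_inv_cancel,
    hρ.one_apply, smul_smul, smul_smul, mul_assoc]
  have := hα.ne_zero g g⁻¹
  have := hα.ne_zero 1 1
  rw [show (α g g⁻¹ * α 1 1)⁻¹ * (α g g⁻¹ * α 1 1) = 1 by field_simp, one_smul]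

theorem IsProjRep.symm_apply_symm_apply (hα : IsUnitaryCocycle α)
    (hρ : IsProjRep α (fun g => (ρ g).toLinearEquiv)) (g h : G) (x : E) :
    (ρ g).symm ((ρ h).symm x) = (α h g)⁻¹ • (ρ (h * g)).symm x := by
  rw [LinearIsometryEquiv.symm_apply_eq, LinearIsometryEquiv.symm_apply_eq, map_smul, map_smul,
    hρ.apply_apply, smul_smul, LinearIsometryEquiv.apply_symm_apply,
    inv_mul_cancel₀ (hα.ne_zero _ _), one_smul]

theorem inner_symm_right (e : E ≃ₗᵢ[ℂ] E) (x y : E) :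
    inner ℂ x (e.symm y) = inner ℂ (e x) y := by
  rw [← e.inner_map_map, e.apply_symm_apply]

theorem inner_symm_left (e : E ≃ₗᵢ[ℂ] E) (x y : E) :
    inner ℂ (e.symm x) y = inner ℂ x (e y) := by
  rw [← e.inner_map_map, e.apply_symm_apply]

/-- The factor `α(a,a⁻¹) α(1,1)` is exactly the phase between `ρ(a⁻¹)` and `ρ(a)⁻¹`. -/
theorem fourier_apply [Fintype G] (hα : IsUnitaryCocycle α)
    (hρ : IsProjRep α (fun g => (ρ g).toLinearEquiv)) (f : G → ℂ) (x : E) :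
    fourier α f (fun g => (ρ g).toLinearEquiv) x = ∑ a, f a • (ρ a).symm x := by
  simp only [fourier, LinearMap.sum_apply, LinearMap.smul_apply]
  refine Finset.sum_congr rfl fun a _ => ?_
  rw [hρ.symm_apply hα, smul_smul, div_eq_mul_inv]
  rfl

theorem fourier_sub {V : Type*} [AddCommGroup V] [Module ℂ V] [Fintype G] (f f' : G → ℂ)
    (τ : G → (V ≃ₗ[ℂ] V)) : fourier α (f - f') τ = fourier α f τ - fourier α f' τ := by
  simp only [fourier, Pi.sub_apply, sub_div, sub_smul, Finset.sum_sub_distrib]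

section Projection

variable {f : G → ℂ}

theorem eq_of_isSelfAdjoint_groupMatrix (hα : IsUnitaryCocycle α)
    (hf : IsSelfAdjoint (groupMatrix α f)) (a : G) :
    f a = α a a⁻¹ * α 1 1 * (starRingEnd ℂ) (f a⁻¹) := by
  have h := congrFun (congrFun hf.star_eq 1) a
  simp only [Matrix.star_apply, groupMatrix, Matrix.of_apply, inv_one, one_mul, mul_one,
    hα.one_left, RCLike.star_def, map_div₀, hα.star_eq_inv, div_inv_eq_mul] at h
  have h1 := hα.ne_zero 1 1
  field_simp at h
  rw [← h]
  ring

variable [Fintype G]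

theorem twistedConvolution_self_of_isIdempotentElem (hα : IsUnitaryCocycle α)
    (hf : IsIdempotentElem (groupMatrix α f)) (c : G) :
    ∑ b, f b * f (b⁻¹ * c) * (α b (b⁻¹ * c))⁻¹ = f c := by
  -- Row `1` suffices, and there the denominators `α(1,·)` are all `α(1,1)`.
  have h := congrFun (congrFun hf.eq 1) c
  simp only [Matrix.mul_apply, groupMatrix, Matrix.of_apply, inv_one, one_mul, hα.one_left] at h
  have h1 := hα.ne_zero 1 1
  calc ∑ b, f b * f (b⁻¹ * c) * (α b (b⁻¹ * c))⁻¹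
      = α 1 1 * ∑ b, f b / α 1 1 * (f (b⁻¹ * c) / α b (b⁻¹ * c)) := by
        rw [Finset.mul_sum]
        refine Finset.sum_congr rfl fun b _ => ?_
        field_simp
    _ = f c := by rw [h]; field_simp

theorem isIdempotentElem_fourier (hα : IsUnitaryCocycle α)
    (hρ : IsProjRep α (fun g => (ρ g).toLinearEquiv))
    (hf : IsIdempotentElem (groupMatrix α f)) :
    IsIdempotentElem (fourier α f (fun g => (ρ g).toLinearEquiv)) := by
  refine LinearMap.ext fun x => ?_
  rw [Module.End.mul_apply, fourier_apply hα hρ, fourier_apply hα hρ]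
  simp only [map_sum, map_smul, hρ.symm_apply_symm_apply hα, Finset.smul_sum, smul_smul]
  rw [Finset.sum_comm]
  -- Inverses reverse products, so the substitution is `c = b * a`, and the inner sum becomes
  -- twisted convolution.
  calc ∑ b, ∑ a, (f a * (f b * (α b a)⁻¹)) • (ρ (b * a)).symm x
      = ∑ b, ∑ c, (f b * f (b⁻¹ * c) * (α b (b⁻¹ * c))⁻¹) • (ρ c).symm x := by
        refine Finset.sum_congr rfl fun b _ => ?_
        refine Fintype.sum_equiv (Equiv.mulLeft b) _ _ fun a => ?_
        simp only [Equiv.coe_mulLeft, inv_mul_cancel_left]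
        ring_nf
    _ = ∑ c, f c • (ρ c).symm x := by
        rw [Finset.sum_comm]
        refine Finset.sum_congr rfl fun c _ => ?_
        rw [← Finset.sum_smul, twistedConvolution_self_of_isIdempotentElem hα hf]

/-- The adjoint of `ρ(a)⁻¹` is `ρ(a)`, a phase times `ρ(a⁻¹)⁻¹`; reindexing by `a ↦ a⁻¹`, the
self-adjointness relation for `f` absorbs that phase. -/
theorem isSymmetric_fourier (hα : IsUnitaryCocycle α)
    (hρ : IsProjRep α (fun g => (ρ g).toLinearEquiv))
    (hf : IsSelfAdjoint (groupMatrix α f)) :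
    (fourier α f (fun g => (ρ g).toLinearEquiv)).IsSymmetric := by
  intro x y
  rw [fourier_apply hα hρ, fourier_apply hα hρ, sum_inner, inner_sum]
  refine Fintype.sum_equiv (Equiv.inv G) _ _ fun a => ?_
  rw [inner_smul_left, inner_smul_right, Equiv.inv_apply, inner_symm_left, hρ.symm_apply hα,
    inner_smul_right, inv_inv, eq_of_isSelfAdjoint_groupMatrix hα hf a⁻¹, inv_inv]
  have := hα.ne_zero a⁻¹ a
  have := hα.ne_zero 1 1
  field_simp

end Projection

theorem orthogonal_invariant (hα : IsUnitaryCocycle α)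
    (hρ : IsProjRep α (fun g => (ρ g).toLinearEquiv)) {W : Submodule ℂ E}
    (hW : ∀ g, ∀ x ∈ W, ρ g x ∈ W) (g : G) (x : E) (hx : x ∈ Wᗮ) : ρ g x ∈ Wᗮ := by
  rw [Submodule.mem_orthogonal] at hx ⊢
  intro y hy
  rw [← inner_symm_left, hρ.symm_apply hα]
  exact hx _ (W.smul_mem _ (hW _ _ hy))

/-! ### Schur's lemma and Schur orthogonality -/

section SchurLemma

variable {G : Type*}

theorem IsIrred.bijective_of_intertwining {V W : Type*} [AddCommGroup V] [Module ℂ V]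
    [AddCommGroup W] [Module ℂ W] {π : G → (V ≃ₗ[ℂ] V)} {τ : G → (W ≃ₗ[ℂ] W)}
    (hπ : IsIrred π) (hτ : IsIrred τ) (T : V →ₗ[ℂ] W) (hT : ∀ g x, T (π g x) = τ g (T x))
    (h0 : T ≠ 0) : Function.Bijective T := by
  constructor
  · rw [← LinearMap.ker_eq_bot]
    refine (hπ.2 (LinearMap.ker T) fun g x hx => ?_).resolve_right fun h => h0 ?_
    · rw [LinearMap.mem_ker] at hx ⊢
      rw [hT, hx, map_zero]
    · exact LinearMap.ker_eq_top.mp h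
  · rw [← LinearMap.range_eq_top]
    refine (hτ.2 (LinearMap.range T) fun g x hx => ?_).resolve_left fun h => h0 ?_
    · obtain ⟨y, rfl⟩ := hx
      exact ⟨π g y, hT g y⟩
    · exact LinearMap.range_eq_bot.mp h

theorem IsIrred.eq_zero_of_intertwining {V W : Type*} [AddCommGroup V] [Module ℂ V]
    [AddCommGroup W] [Module ℂ W] {π : G → (V ≃ₗ[ℂ] V)} {τ : G → (W ≃ₗ[ℂ] W)}
    (hπ : IsIrred π) (hτ : IsIrred τ) (hne : ¬ Equivalent π τ) (T : V →ₗ[ℂ] W)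
    (hT : ∀ g x, T (π g x) = τ g (T x)) : T = 0 := by
  by_contra h0
  exact hne ⟨LinearEquiv.ofBijective T (hπ.bijective_of_intertwining hτ T hT h0), hT⟩

theorem IsIrred.exists_eq_smul_of_commute {V : Type*} [AddCommGroup V] [Module ℂ V]
    [FiniteDimensional ℂ V] {π : G → (V ≃ₗ[ℂ] V)} (hπ : IsIrred π) (T : V →ₗ[ℂ] V)
    (hT : ∀ g x, T (π g x) = π g (T x)) : ∃ c : ℂ, T = c • LinearMap.id := by
  have := hπ.1
  obtain ⟨c, hc⟩ := Module.End.exists_eigenvalue T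
  refine ⟨c, ?_⟩
  obtain ⟨x, hx⟩ := hc.exists_hasEigenvector
  by_contra hne
  -- A nonzero `T - c` would be injective, but it kills the eigenvector `x`.
  have hb := hπ.bijective_of_intertwining hπ (T - c • LinearMap.id) (fun g x => by
    simp [hT]) (sub_ne_zero.mpr hne)
  refine hx.2 (hb.1 ?_)
  simp [hx.apply_eq_smul]

end SchurLemma

section Schur

variable [Fintype G]

/-- The operator `x ↦ ∑ g, ⟨ρ(g)w, x⟩ σ(g)w'` (with the inner product linear in `x`). -/
noncomputable def averageRankOne (ρ : G → (E ≃ₗᵢ[ℂ] E)) (σ : G → (F ≃ₗᵢ[ℂ] F)) (w : E) (w' : F) :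
    E →ₗ[ℂ] F :=
  ∑ g, (InnerProductSpace.rankOne ℂ (σ g w') (ρ g w)).toLinearMap

theorem averageRankOne_apply (w : E) (w' : F) (x : E) :
    averageRankOne ρ σ w w' x = ∑ g, (inner ℂ (ρ g w) x) • σ g w' := by
  simp [averageRankOne, LinearMap.sum_apply]

/-- Reindex by `g ↦ kg`: the phase `α(k,g)` from `σ` cancels its conjugate from `ρ`, as `|α| = 1`.
-/
theorem averageRankOne_intertwining (hα : IsUnitaryCocycle α)
    (hρ : IsProjRep α (fun g => (ρ g).toLinearEquiv))
    (hσ : IsProjRep α (fun g => (σ g).toLinearEquiv)) (w : E) (w' : F) (k : G) (x : E) :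
    averageRankOne ρ σ w w' (ρ k x) = σ k (averageRankOne ρ σ w w' x) := by
  rw [averageRankOne_apply, averageRankOne_apply, map_sum]
  symm
  refine Fintype.sum_equiv (Equiv.mulLeft k) _ _ fun g => ?_
  rw [Equiv.coe_mulLeft, map_smul, hσ.apply_apply, ← (ρ k).inner_map_map, hρ.apply_apply,
    inner_smul_left, hα.star_eq_inv, smul_smul]
  have := hα.ne_zero k g
  congr 1
  field_simp

/-- Schur orthogonality for inequivalent irreducible projective representations. -/
theorem sum_inner_smul_eq_zero (hα : IsUnitaryCocycle α)
    (hρ : IsProjRep α (fun g => (ρ g).toLinearEquiv))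
    (hσ : IsProjRep α (fun g => (σ g).toLinearEquiv))
    (hρi : IsIrred (fun g => (ρ g).toLinearEquiv)) (hσi : IsIrred (fun g => (σ g).toLinearEquiv))
    (hne : ¬ Equivalent (fun g => (ρ g).toLinearEquiv) (fun g => (σ g).toLinearEquiv))
    (w : E) (w' : F) (x : E) : ∑ g, (inner ℂ (ρ g w) x) • σ g w' = 0 := by
  rw [← averageRankOne_apply, hρi.eq_zero_of_intertwining hσi hne _
    (averageRankOne_intertwining hα hρ hσ w w'), LinearMap.zero_apply]

/-- Schur orthogonality for a single irreducible projective representation. -/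
theorem sum_inner_smul_self [FiniteDimensional ℂ E] (hα : IsUnitaryCocycle α)
    (hρ : IsProjRep α (fun g => (ρ g).toLinearEquiv))
    (hρi : IsIrred (fun g => (ρ g).toLinearEquiv)) (w w' : E) (x : E) :
    ∑ g, (inner ℂ (ρ g w) x) • ρ g w' =
      ((Fintype.card G : ℂ) / (Module.finrank ℂ E : ℂ) * inner ℂ w w') • x := by
  obtain ⟨c, hc⟩ := hρi.exists_eq_smul_of_commute _ (averageRankOne_intertwining hα hρ hρ w w')
  -- By unitarity each of the `|G|` rank-one terms has trace `⟨w, w'⟩`; comparing with the trace of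
  -- `c • id` determines `c`.
  have htr : LinearMap.trace ℂ E (averageRankOne ρ ρ w w') =
      (Fintype.card G : ℂ) * inner ℂ w w' := by
    simp [averageRankOne, InnerProductSpace.trace_rankOne]
  rw [hc, map_smul, LinearMap.trace_id, smul_eq_mul] at htr
  have := hρi.1
  have hd : (Module.finrank ℂ E : ℂ) ≠ 0 := Nat.cast_ne_zero.mpr Module.finrank_pos.ne'
  rw [← averageRankOne_apply, hc, LinearMap.smul_apply, LinearMap.id_apply]
  congr 1
  field_simp
  exact htr

end Schur

end UnitaryRepresentations

end TwistedFrame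

namespace TwistedFrame

/-! ### Injectivity of the Fourier transform and finiteness of the family -/

section Vanishing

variable {G : Type*} [Group G] [Fintype G] {α : G → G → ℂ} {ι : Type*} {d : ι → ℕ}
  {ξ : (i : ι) → G → (EuclideanSpace ℂ (Fin (d i)) ≃ₗᵢ[ℂ] EuclideanSpace ℂ (Fin (d i)))}
  {f : G → ℂ}

/-- Completeness speaks only of the spaces `ℂⁿ`, so `π` is first transported along a basis. -/
theorem IsCompleteIrredSet.fourier_eq_zero_of_isIrred (hξ : IsCompleteIrredSet α d ξ)
    (hf : ∀ i, fourier α f (fun g => (ξ i g).toLinearEquiv) = 0)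
    {V : Type*} [AddCommGroup V] [Module ℂ V] [FiniteDimensional ℂ V] {π : G → (V ≃ₗ[ℂ] V)}
    (hπ : IsProjRep α π) (hπi : IsIrred π) : fourier α f π = 0 := by
  have := hπi.1
  let e : V ≃ₗ[ℂ] EuclideanSpace ℂ (Fin (Module.finrank ℂ V)) :=
    LinearEquiv.ofFinrankEq _ _ (by simp)
  let τ : G → (EuclideanSpace ℂ (Fin (Module.finrank ℂ V)) ≃ₗ[ℂ]
      EuclideanSpace ℂ (Fin (Module.finrank ℂ V))) := fun g => e.symm ≪≫ₗ π g ≪≫ₗ e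
  have hτ (g x) : τ g x = e (π g (e.symm x)) := rfl
  obtain ⟨i, T, hT⟩ := hξ.complete _ τ
    (fun g h x => by simp only [hτ, e.symm_apply_apply, hπ g h, map_smul])
    ⟨e.symm.toEquiv.nontrivial, fun U hU => by
      rcases hπi.2 (U.comap e.toLinearMap) (fun g x hx => by
        have := hU g _ hx
        simpa [hτ] using this) with h | h
      · left
        refine (Submodule.eq_bot_iff _).2 fun x hx => ?_
        have h2 := (Submodule.eq_bot_iff _).1 h (e.symm x) (by simpa using hx)
        simpa using h2
      · right
        refine (Submodule.eq_top_iff').2 fun x => ?_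
        have h2 := (Submodule.eq_top_iff').1 h (e.symm x)
        simpa using h2⟩
  refine LinearMap.ext fun x => (e ≪≫ₗ T).injective ?_
  have h2 (g x) : T (e (π g x)) = ξ i g (T (e x)) := by
    have := hT g (e x)
    rwa [hτ, e.symm_apply_apply] at this
  have h := LinearMap.congr_fun (hf i) (T (e x))
  simp only [fourier, LinearMap.sum_apply, LinearMap.smul_apply, LinearMap.zero_apply] at h
  simp only [fourier, LinearMap.sum_apply, LinearMap.smul_apply, LinearMap.zero_apply, map_sum,
    map_smul, map_zero, LinearEquiv.trans_apply, LinearEquiv.coe_coe, h2]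
  exact h

/-- Maschke's theorem as an induction on dimension: a reducible `U` splits as `W` plus `Wᗮ ⊓ U`,
both invariant and smaller; otherwise `U` is zero or irreducible. -/
theorem IsCompleteIrredSet.fourier_apply_eq_zero_of_mem (hα : IsUnitaryCocycle α)
    (hξ : IsCompleteIrredSet α d ξ)
    (hf : ∀ i, fourier α f (fun g => (ξ i g).toLinearEquiv) = 0)
    {E : Type*} [NormedAddCommGroup E] [InnerProductSpace ℂ E] [FiniteDimensional ℂ E]
    {ρ : G → (E ≃ₗᵢ[ℂ] E)} (hρ : IsProjRep α (fun g => (ρ g).toLinearEquiv)) (n : ℕ) :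
    ∀ U : Submodule ℂ E, Module.finrank ℂ U = n → (∀ g, ∀ x ∈ U, ρ g x ∈ U) → ∀ x ∈ U,
      fourier α f (fun g => (ρ g).toLinearEquiv) x = 0 := by
  induction n using Nat.strong_induction_on with
  | _ n ih =>
    intro U hn hU x hx
    by_cases hW : ∃ W ≤ U, W ≠ ⊥ ∧ W ≠ U ∧ ∀ g, ∀ x ∈ W, ρ g x ∈ W
    · obtain ⟨W, hWU, hW0, hWne, hWinv⟩ := hW
      have h1 : W < U := lt_of_le_of_ne hWU hWne
      have h2 : Wᗮ ⊓ U < U := by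
        refine lt_of_le_of_ne inf_le_right fun h => hW0 ?_
        have h3 : W ≤ Wᗮ := hWU.trans (inf_eq_right.mp h)
        exact (Submodule.eq_bot_iff _).2 fun y hy =>
          inner_self_eq_zero.mp ((Submodule.mem_orthogonal _ _).1 (h3 hy) y hy)
      obtain ⟨y, hy, z, hz, rfl⟩ := W.exists_add_mem_mem_orthogonal x
      have hzU : z ∈ U := by simpa using U.sub_mem hx (hWU hy)
      rw [map_add, ih _ (hn ▸ Submodule.finrank_lt_finrank_of_lt h1) W rfl hWinv y hy,
        ih _ (hn ▸ Submodule.finrank_lt_finrank_of_lt h2) (Wᗮ ⊓ U) rfl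
          (fun g t ht => ⟨orthogonal_invariant hα hρ hWinv g t ht.1, hU g t ht.2⟩) z ⟨hz, hzU⟩,
        add_zero]
    · push Not at hW
      by_cases hU0 : U = ⊥
      · rw [hU0, Submodule.mem_bot] at hx
        rw [hx, map_zero]
      let π : G → (U ≃ₗ[ℂ] U) := fun g =>
        LinearEquiv.ofInjectiveEndo ((ρ g).toLinearEquiv.toLinearMap.restrict (hU g))
          fun a b hab => Subtype.ext ((ρ g).injective (congrArg Subtype.val hab))
      have hπ (g x) : (π g x : E) = ρ g x := rfl
      have hirr : IsIrred π := by
        refine ⟨Submodule.nontrivial_iff_ne_bot.mpr hU0, fun W hWinv => ?_⟩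
        by_contra! hcon
        refine hcon.2 ?_
        have hmap := hW (W.map U.subtype) (Submodule.map_subtype_le _ _)
          (fun h => hcon.1 (Submodule.map_injective_of_injective U.injective_subtype (by
            rw [h, Submodule.map_bot])))
        by_contra hne
        obtain ⟨g, y, hy, hy'⟩ := hmap fun h => hne
          (Submodule.map_injective_of_injective U.injective_subtype
            (h.trans (Submodule.map_subtype_top U).symm))
        obtain ⟨t, ht, rfl⟩ := hy
        exact hy' ⟨π g t, hWinv g t ht, rfl⟩
      have hzero := hξ.fourier_eq_zero_of_isIrred hf (π := π)
        (fun g h x => Subtype.ext (hρ g h x)) hirr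
      have h := congrArg Subtype.val (LinearMap.congr_fun hzero ⟨x, hx⟩)
      simp only [fourier, LinearMap.sum_apply, LinearMap.smul_apply, LinearEquiv.coe_coe,
        LinearMap.zero_apply, Submodule.coe_sum, Submodule.coe_smul, hπ,
        Submodule.coe_zero] at h
      simpa [fourier, LinearMap.sum_apply] using h

/-- The `α`-twisted left regular representation, `ρ(g) e_h = α(g,h) e_{gh}`. -/
noncomputable def regularRep (hα : IsUnitaryCocycle α) (g : G) :
    EuclideanSpace ℂ G ≃ₗᵢ[ℂ] EuclideanSpace ℂ G where
  toFun x := WithLp.toLp 2 fun k => α g (g⁻¹ * k) * x (g⁻¹ * k)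
  invFun x := WithLp.toLp 2 fun k => (α g k)⁻¹ * x (g * k)
  left_inv x := by
    ext k
    simp [hα.ne_zero]
  right_inv x := by
    ext k
    simp [hα.ne_zero]
  map_add' x y := by
    ext k
    simp [mul_add]
  map_smul' c x := by
    ext k
    simp only [PiLp.smul_apply, smul_eq_mul, RingHom.id_apply]
    ring
  norm_map' x := by
    simp only [EuclideanSpace.norm_eq, LinearEquiv.coe_mk, LinearMap.coe_mk, AddHom.coe_mk,
      norm_mul, hα.norm_eq_one, one_mul]
    congr 1
    exact Fintype.sum_equiv (Equiv.mulLeft g⁻¹) _ _ fun k => rfl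

theorem isProjRep_regularRep (hα : IsUnitaryCocycle α) :
    IsProjRep α (fun g => (regularRep hα g).toLinearEquiv) := by
  intro g h x
  ext k
  change α g (g⁻¹ * k) * (α h (h⁻¹ * (g⁻¹ * k)) * x (h⁻¹ * (g⁻¹ * k))) =
    α g h * (α (g * h) ((g * h)⁻¹ * k) * x ((g * h)⁻¹ * k))
  have hc := hα.cocycle g h ((g * h)⁻¹ * k)
  rw [mul_inv_rev, mul_assoc, mul_inv_cancel_left] at hc
  rw [mul_inv_rev, mul_assoc h⁻¹, ← mul_assoc (α g _), ← mul_assoc (α g h), hc]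

/-- Injectivity of the `α`-Fourier transform. -/
theorem IsCompleteIrredSet.eq_zero_of_fourier_eq_zero (hα : IsUnitaryCocycle α)
    (hξ : IsCompleteIrredSet α d ξ)
    (hf : ∀ i, fourier α f (fun g => (ξ i g).toLinearEquiv) = 0) : f = 0 := by
  classical
  funext b
  have h := hξ.fourier_apply_eq_zero_of_mem hα hf (isProjRep_regularRep hα) _ ⊤ rfl
    (fun _ _ _ => Submodule.mem_top) (EuclideanSpace.single b 1) Submodule.mem_top
  rw [fourier_apply hα (isProjRep_regularRep hα)] at h
  -- Coordinate `1` of `ρ(a)⁻¹ e_b` vanishes unless `a = b`, so only `f b / α(b,1)` survives.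
  have h1 := congrArg (fun x : EuclideanSpace ℂ G => x 1) h
  have hs (a : G) (x : EuclideanSpace ℂ G) (k : G) :
      (regularRep hα a).symm x k = (α a k)⁻¹ * x (a * k) := rfl
  simpa [hs, Pi.single_apply, hα.ne_zero] using h1

/-- One diagonal matrix coefficient per member gives nonzero, pairwise orthogonal vectors in the
finite-dimensional space `ℂ^G`. -/
theorem IsCompleteIrredSet.finite (hα : IsUnitaryCocycle α) (hξ : IsCompleteIrredSet α d ξ) :
    Finite ι := by
  have hex (i) : ∃ w : EuclideanSpace ℂ (Fin (d i)), w ≠ 0 :=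
    have := (hξ.irred i).1
    exists_ne 0
  choose w hw using hex
  let v : ι → EuclideanSpace ℂ G := fun i => WithLp.toLp 2 fun g => inner ℂ (w i) (ξ i g (w i))
  have hv0 (i) : v i ≠ 0 := by
    intro h
    have h1 : inner ℂ (w i) (ξ i 1 (w i)) = 0 := congrArg (fun x : EuclideanSpace ℂ G => x 1) h
    rw [(hξ.projRep i).one_apply, inner_smul_right] at h1
    rcases mul_eq_zero.mp h1 with h2 | h2
    · exact hα.ne_zero _ _ h2
    · exact hw i (inner_self_eq_zero.mp h2)
  have horth : Pairwise fun i j => inner ℂ (v i) (v j) = 0 := by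
    intro i j hij
    have h := sum_inner_smul_eq_zero hα (hξ.projRep i) (hξ.projRep j) (hξ.irred i) (hξ.irred j)
      (fun h => hij (hξ.inequivalent i j h)) (w i) (w j) (w i)
    have h2 := congrArg (fun x => inner ℂ (w j) x) h
    simp only [inner_sum, inner_smul_right, inner_zero_right] at h2
    rw [← h2, PiLp.inner_apply]
    refine Finset.sum_congr rfl fun g _ => ?_
    simp only [v, RCLike.inner_apply, inner_conj_symm]
    ring
  exact (linearIndependent_of_ne_zero_of_inner_eq_zero hv0 horth).finite

end Vanishing

end TwistedFrame

namespace TwistedFrame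

/-! ### Orthogonal projections as sums of rank-one projections -/

section Decomposition

variable {E : Type*} [NormedAddCommGroup E] [InnerProductSpace ℂ E]

theorem exists_orthonormal_eq_sum_rankOne [FiniteDimensional ℂ E] {T : E →ₗ[ℂ] E} (hT : T.IsSymmetricProjection) :
    ∃ (n : ℕ) (w : Fin n → E), Orthonormal ℂ w ∧
      T = ∑ j, (InnerProductSpace.rankOne ℂ (w j) (w j)).toLinearMap := by
  let b := stdOrthonormalBasis ℂ (LinearMap.range T)
  refine ⟨_, fun j => (b j : E), b.orthonormal.comp_linearIsometry (LinearMap.range T).subtypeₗᵢ,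
    ?_⟩
  obtain ⟨_, h⟩ := LinearMap.isSymmetricProjection_iff_eq_coe_starProjection_range.mp hT
  conv_lhs => rw [h, b.starProjection_eq_sum_rankOne]
  ext x
  simp [LinearMap.sum_apply]

theorem finrank_range_sum_rankOne {n : ℕ} {w : Fin n → E} (hw : Orthonormal ℂ w) :
    Module.finrank ℂ (LinearMap.range
      (∑ j, (InnerProductSpace.rankOne ℂ (w j) (w j)).toLinearMap : E →ₗ[ℂ] E)) = n := by
  have h : LinearMap.range
      (∑ j, (InnerProductSpace.rankOne ℂ (w j) (w j)).toLinearMap : E →ₗ[ℂ] E) =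
      Submodule.span ℂ (Set.range w) := by
    apply le_antisymm
    · rintro _ ⟨x, rfl⟩
      simp only [LinearMap.sum_apply, ContinuousLinearMap.coe_coe,
        InnerProductSpace.rankOne_apply]
      exact Submodule.sum_mem _ fun j _ =>
        Submodule.smul_mem _ _ (Submodule.subset_span ⟨j, rfl⟩)
    · rw [Submodule.span_le]
      rintro _ ⟨k, rfl⟩
      refine ⟨w k, ?_⟩
      simp [LinearMap.sum_apply, orthonormal_iff_ite.mp hw]
  rw [h, finrank_span_eq_card hw.linearIndependent, Fintype.card_fin]

end Decomposition

/-! ### Fourier inversion, the frame property and the Gramian -/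

section Frame

variable {G : Type*} [Group G] [Fintype G] {α : G → G → ℂ} {ι : Type*} {d : ι → ℕ}
  {ξ : (i : ι) → G → (EuclideanSpace ℂ (Fin (d i)) ≃ₗᵢ[ℂ] EuclideanSpace ℂ (Fin (d i)))}
  {f : G → ℂ} {m : ι → ℕ} {w : (i : ι) → Fin (m i) → EuclideanSpace ℂ (Fin (d i))}

theorem IsCompleteIrredSet.dim_ne_zero (hξ : IsCompleteIrredSet α d ξ) (i : ι) :
    (d i : ℂ) ≠ 0 := by
  have := (hξ.irred i).1
  have h : 0 < Module.finrank ℂ (EuclideanSpace ℂ (Fin (d i))) := Module.finrank_pos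
  rw [finrank_euclideanSpace_fin] at h
  exact Nat.cast_ne_zero.mpr h.ne'

theorem card_ne_zero_complex : (Fintype.card G : ℂ) ≠ 0 :=
  Nat.cast_ne_zero.mpr Fintype.card_ne_zero

variable [Fintype ι]

/-- Fourier inversion, for Fourier coefficients written as sums of rank-one operators. -/
theorem IsFourierDecomposition.inversion (hα : IsUnitaryCocycle α)
    (hξ : IsCompleteIrredSet α d ξ) (hw : IsFourierDecomposition α f ξ m w) (c : G) :
    f c = ∑ i, (d i : ℂ) / Fintype.card G * ∑ j, inner ℂ (w i j) (ξ i c (w i j)) := by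
  -- By injectivity it is enough that `f'` and `f` have the same Fourier coefficients.
  let f' : G → ℂ := fun c =>
    ∑ i, (d i : ℂ) / Fintype.card G * ∑ j, inner ℂ (w i j) (ξ i c (w i j))
  suffices h : f - f' = 0 from congrFun (sub_eq_zero.mp h) c
  refine hξ.eq_zero_of_fourier_eq_zero hα fun k => ?_
  rw [fourier_sub, sub_eq_zero, (hw k).2]
  refine LinearMap.ext fun y => ext_inner_left ℂ fun x => ?_
  rw [fourier_apply hα (hξ.projRep k)]
  have hterm (i : ι) (j : Fin (m i)) :
      inner ℂ (w i j) (∑ c, (inner ℂ (ξ k c x) y) • ξ i c (w i j)) =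
        ∑ c, inner ℂ (w i j) (ξ i c (w i j)) * inner ℂ (ξ k c x) y := by
    simp only [inner_sum, inner_smul_right, mul_comm]
  -- Schur orthogonality is used backwards: `|G|/d_k` cancels the weight, and the terms `i ≠ k`
  -- added next are zero.
  calc inner ℂ x ((∑ j, (InnerProductSpace.rankOne ℂ (w k j) (w k j)).toLinearMap :
          _ →ₗ[ℂ] _) y)
      = (d k : ℂ) / Fintype.card G *
          ∑ j, inner ℂ (w k j) (∑ c, (inner ℂ (ξ k c x) y) • ξ k c (w k j)) := by
        simp only [sum_inner_smul_self hα (hξ.projRep k) (hξ.irred k), inner_smul_right,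
          finrank_euclideanSpace_fin, LinearMap.sum_apply, ContinuousLinearMap.coe_coe,
          InnerProductSpace.rankOne_apply, inner_sum, Finset.mul_sum]
        refine Finset.sum_congr rfl fun j _ => ?_
        have := hξ.dim_ne_zero k
        have := card_ne_zero_complex (G := G)
        field_simp
    _ = ∑ i, (d i : ℂ) / Fintype.card G *
          ∑ j, inner ℂ (w i j) (∑ c, (inner ℂ (ξ k c x) y) • ξ i c (w i j)) := by
        rw [Finset.sum_eq_single k]
        · intro i _ hik
          simp only [sum_inner_smul_eq_zero hα (hξ.projRep k) (hξ.projRep i) (hξ.irred k)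
            (hξ.irred i) (fun h => hik (hξ.inequivalent k i h).symm), inner_zero_right,
            Finset.sum_const_zero, mul_zero]
        · simp
    _ = inner ℂ x (∑ c, f' c • (ξ k c).symm y) := by
        simp only [hterm, inner_sum, inner_smul_right, inner_symm_right, f', Finset.sum_mul,
          Finset.mul_sum]
        rw [Finset.sum_comm' (s := Finset.univ) (t' := Finset.univ) (s' := fun _ => Finset.univ)
          (t := fun _ => Finset.univ) (by simp)]
        refine Finset.sum_congr rfl fun i _ => ?_
        rw [Finset.sum_comm]
        simp only [mul_assoc]

theorem constructAction_constructVector_apply (g : G) (i : ι) (j : Fin (m i)) :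
    constructAction ξ m g (constructVector G w) i j =
      ((Real.sqrt ((d i : ℝ) / (Fintype.card G : ℝ)) : ℝ) : ℂ) • ξ i g (w i j) := by
  simp [constructAction, constructVector]

theorem sqrt_dim_div_card_mul_self (n : ℕ) :
    ((Real.sqrt ((n : ℝ) / (Fintype.card G : ℝ)) : ℝ) : ℂ) *
      ((Real.sqrt ((n : ℝ) / (Fintype.card G : ℝ)) : ℝ) : ℂ) = (n : ℂ) / Fintype.card G := by
  rw [← Complex.ofReal_mul, Real.mul_self_sqrt (by positivity)]
  push_cast
  rfl

theorem isProjRep_constructAction (hξ : ∀ i, IsProjRep α (fun g => (ξ i g).toLinearEquiv)) :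
    IsProjRep α (fun g => (constructAction ξ m g).toLinearEquiv) := by
  intro g h x
  ext i j : 2
  exact hξ i g h (x i j)

/-- Inequivalence removes the cross terms between blocks, orthonormality those between copies of one
`ξ`, and the squared scaling `d_ξ/|G|` cancels the Schur constant. -/
theorem isNormalisedTightFrame_construct (hα : IsUnitaryCocycle α)
    (hξ : IsCompleteIrredSet α d ξ) (hw : ∀ i, Orthonormal ℂ (w i)) :
    IsNormalisedTightFrame (fun g : G => constructAction ξ m g (constructVector G w)) := by
  intro x
  ext k l : 2
  have hterm (i : ι) (j : Fin (m i)) (r s : ℂ) :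
      ∑ g, (inner ℂ (r • ξ i g (w i j)) (x i j)) • s • ξ k g (w k l) =
        ((starRingEnd ℂ) r * s) • ∑ g, (inner ℂ (ξ i g (w i j)) (x i j)) • ξ k g (w k l) := by
    simp only [inner_smul_left, smul_smul, Finset.smul_sum]
    refine Finset.sum_congr rfl fun g _ => ?_
    ring_nf
  have happly : (∑ g, (inner ℂ (constructAction ξ m g (constructVector G w)) x) •
      constructAction ξ m g (constructVector G w)) k l =
      ∑ g, (inner ℂ (constructAction ξ m g (constructVector G w)) x) •
        (constructAction ξ m g (constructVector G w) k l) := by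
    simp
  rw [happly]
  simp only [PiLp.inner_apply (𝕜 := ℂ) (f := fun i : ι => PiLp 2 (fun _ : Fin (m i) =>
      EuclideanSpace ℂ (Fin (d i)))),
    PiLp.inner_apply (𝕜 := ℂ) (f := fun _ : Fin (m _) => EuclideanSpace ℂ (Fin (d _))),
    constructAction_constructVector_apply, Finset.sum_smul]
  rw [Finset.sum_comm, Finset.sum_eq_single k]
  · rw [Finset.sum_comm]
    simp only [hterm, sum_inner_smul_self hα (hξ.projRep k) (hξ.irred k),
      orthonormal_iff_ite.mp (hw k), Complex.conj_ofReal, sqrt_dim_div_card_mul_self,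
      finrank_euclideanSpace_fin, mul_ite, mul_one, mul_zero, ite_smul, zero_smul, smul_ite,
      smul_zero, Finset.sum_ite_eq', Finset.mem_univ, if_true]
    rw [smul_smul]
    have h1 := hξ.dim_ne_zero k
    have h2 := card_ne_zero_complex (G := G)
    rw [show (d k : ℂ) / Fintype.card G * (Fintype.card G / d k) = 1 by field_simp, one_smul]
  · intro i _ hik
    rw [Finset.sum_comm]
    simp only [hterm, sum_inner_smul_eq_zero hα (hξ.projRep i) (hξ.projRep k) (hξ.irred i)
      (hξ.irred k) (fun h => hik (hξ.inequivalent i k h)), smul_zero, Finset.sum_const_zero]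
  · simp

theorem gram_construct (hα : IsUnitaryCocycle α) (hξ : IsCompleteIrredSet α d ξ)
    (hw : IsFourierDecomposition α f ξ m w) :
    Matrix.gram ℂ (fun g : G => constructAction ξ m g (constructVector G w)) =
      groupMatrix α f := by
  ext g h
  rw [Matrix.gram_apply, groupMatrix, Matrix.of_apply, hw.inversion hα hξ, Finset.sum_div]
  simp only [PiLp.inner_apply (𝕜 := ℂ) (f := fun i : ι => PiLp 2 (fun _ : Fin (m i) =>
      EuclideanSpace ℂ (Fin (d i)))),
    PiLp.inner_apply (𝕜 := ℂ) (f := fun _ : Fin (m _) => EuclideanSpace ℂ (Fin (d _))),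
    constructAction_constructVector_apply]
  refine Finset.sum_congr rfl fun i _ => ?_
  rw [Finset.mul_sum, Finset.sum_div]
  refine Finset.sum_congr rfl fun j _ => ?_
  -- From `ξ(g) ξ(g⁻¹h) = α(g,g⁻¹h) ξ(h)` comes the denominator of the group matrix.
  have h1 := (hξ.projRep i).apply_apply g (g⁻¹ * h) (w i j)
  rw [mul_inv_cancel_left] at h1
  have h2 : inner ℂ (w i j) (ξ i (g⁻¹ * h) (w i j)) =
      α g (g⁻¹ * h) * inner ℂ (ξ i g (w i j)) (ξ i h (w i j)) := by
    rw [← (ξ i g).inner_map_map, h1, inner_smul_right]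
  rw [h2, inner_smul_left, inner_smul_right, Complex.conj_ofReal, ← mul_assoc,
    sqrt_dim_div_card_mul_self]
  have := hα.ne_zero g (g⁻¹ * h)
  field_simp

/-- Row `1` of the Gramian is `f` up to nonzero factors, and its `(1,1)` entry is `‖v‖²`. -/
theorem constructVector_ne_zero_iff (hα : IsUnitaryCocycle α) (hξ : IsCompleteIrredSet α d ξ)
    (hw : IsFourierDecomposition α f ξ m w) : constructVector G w ≠ 0 ↔ f ≠ 0 := by
  have hgram := gram_construct hα hξ hw
  refine not_congr ⟨fun h => ?_, fun h => ?_⟩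
  · funext a
    have h1 := congrFun (congrFun hgram 1) a
    rw [Matrix.gram_apply, h, map_zero, inner_zero_left, groupMatrix, Matrix.of_apply, inv_one,
      one_mul, eq_comm, div_eq_zero_iff] at h1
    exact h1.resolve_right (hα.ne_zero _ _)
  · have h1 := congrFun (congrFun hgram 1) 1
    rw [Matrix.gram_apply, LinearIsometryEquiv.inner_map_map, groupMatrix, Matrix.of_apply, h,
      Pi.zero_apply, zero_div] at h1
    exact inner_self_eq_zero.mp h1

end Frame

end TwistedFrame

theorem mainTheorem3 {G : Type*} [Group G] [Fintype G] (α : G → G → ℂ)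
    (hα : TwistedFrame.IsUnitaryCocycle α) {ι : Type*} (d : ι → ℕ)
    (ξ : (i : ι) → G → (EuclideanSpace ℂ (Fin (d i)) ≃ₗᵢ[ℂ] EuclideanSpace ℂ (Fin (d i))))
    (hξ : TwistedFrame.IsCompleteIrredSet α d ξ) (f : G → ℂ)
    (hf : IsStarProjection (TwistedFrame.groupMatrix α f)) :
    Finite ι ∧
    (∀ i, (TwistedFrame.fourier α f (fun g => (ξ i g).toLinearEquiv)).IsSymmetricProjection) ∧
    (∃ (m : ι → ℕ) (w : (i : ι) → Fin (m i) → EuclideanSpace ℂ (Fin (d i))),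
      TwistedFrame.IsFourierDecomposition α f ξ m w) ∧
    ∀ (m : ι → ℕ) (w : (i : ι) → Fin (m i) → EuclideanSpace ℂ (Fin (d i))),
      TwistedFrame.IsFourierDecomposition α f ξ m w →
      (∀ i, Module.finrank ℂ
        (LinearMap.range (TwistedFrame.fourier α f (fun g => (ξ i g).toLinearEquiv))) = m i) ∧
      ∀ [Fintype ι],
        TwistedFrame.IsNormalisedTightGroupFrame α (TwistedFrame.constructAction ξ m)
          (TwistedFrame.constructVector G w) ∧
        Matrix.gram ℂ (fun g : G =>
          TwistedFrame.constructAction ξ m g (TwistedFrame.constructVector G w)) =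
            TwistedFrame.groupMatrix α f ∧
        (TwistedFrame.constructVector G w ≠ 0 ↔ f ≠ 0) := by
  have hsp (i) :
      (TwistedFrame.fourier α f (fun g => (ξ i g).toLinearEquiv)).IsSymmetricProjection :=
    ⟨TwistedFrame.isIdempotentElem_fourier hα (hξ.projRep i) hf.isIdempotentElem,
      TwistedFrame.isSymmetric_fourier hα (hξ.projRep i) hf.isSelfAdjoint⟩
  refine ⟨hξ.finite hα, hsp, ?_, fun m w hw => ⟨fun i => ?_, fun {_} => ⟨⟨?_, ?_⟩, ?_, ?_⟩⟩⟩
  · choose m w hw using fun i => TwistedFrame.exists_orthonormal_eq_sum_rankOne (hsp i)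
    exact ⟨m, w, hw⟩
  · rw [(hw i).2, TwistedFrame.finrank_range_sum_rankOne (hw i).1]
  · exact TwistedFrame.isProjRep_constructAction hξ.projRep
  · exact TwistedFrame.isNormalisedTightFrame_construct hα hξ fun i => (hw i).1
  · exact TwistedFrame.gram_construct hα hξ hw
  · exact TwistedFrame.constructVector_ne_zero_iff hα hξ hw
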